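/- Let $m,d,N$ be natural numbers, let $\pi=(\pi_1,\dots,\pi_m)$ be a probability vector, and let $A^{[\ell]}_k$ ($1\le\ell\le N$, $1\le k\le d$) be complex $m\times m$ matrices with $\sum_{k=1}^d A^{[\ell]}_k A^{[\ell]\dagger}_k=\mathrm{id}_m$ for every $\ell$. Write $\diamond$ for the entrywise (Schur) product, $|A|^2_\diamond=A\diamond\overline{A}$, $\pi^\dagger=\sum_i\pi_i e_i^\dagger$, $e=\frac1{\sqrt m}\sum_j e_j$, and define on $(\mathbb C^d)^{\otimes N}$ $$|\psi_N\rangle=\sum_{k_1,\dots,k_N}\mathrm{Tr}\big(A^{[1]}_{k_1}\cdots A^{[N]}_{k_N}\big)|k_1\cdots k_N\rangle,\qquad \rho_N=\tfrac1m|\psi_N\rangle\langle\psi_N|,$$ $$\rho_{O;N}=\sqrt m\sum_{k,k'}\pi^\dagger\big(A^{[1]}_{k_1}\diamond\overline{A^{[1]}_{k'_1}}\big)\cdots\big(A^{[N]}_{k_N}\diamond\overline{A^{[N]}_{k'_N}}\big)e\;|k_1\cdots k_N\rangle\langle k'_1\cdots k'_N| .$$ For positive semidefinite matrices $\rho,\sigma$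 let $S(\rho\|\sigma)=\mathrm{Tr}(\rho\log\rho)-\mathrm{Tr}(\rho\log\sigma)$ if $\mathrm{supp}\,\rho\subseteq\mathrm{supp}\,\sigma$, and $S(\rho\|\sigma)=+\infty$ otherwise ($\rho_N$ need not have trace $1$). Then $$S(\rho_N\|\rho_{O;N})\;\ge\;\frac1m\sum_{k_1,\dots,k_N}\Big|\mathrm{Tr}\big(A^{[1]}_{k_1}\cdots A^{[N]}_{k_N}\big)\Big|^2\log\frac{\big|\mathrm{Tr}\big(A^{[1]}_{k_1}\cdots A^{[N]}_{k_N}\big)\big|^2}{m^{3/2}\,\pi^\dagger\Big(\prod_{\ell=1}^N\big|A^{[\ell]}_{k_\ell}\big|^2_\diamond\Big)e},$$ where a summand $x\log(x/y)$ is $0$ if $x=0$, and $+\infty$ if $x>0=y$. Moreover, suppose that the tensors come from an entangled hidden Markov model with initial law $\pi$, that is, the entries of $A^{[\ell]}_k$ are $U^{[\ell]}_{ij}\chi^{[\ell]}_i(k)$ with $\sum_j|U^{[\ell]}_{ij}|^2=1$ and $\sum_k|\chi^{[\ell]}_i(k)|^2=1$ for all $\ell,i$. Then the same inequality holds with $\rho_{O;N}=\mathrm{Tr}_{(\mathbb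 C^m)^{\otimes(N+1)}}|\Psi_{H,O;N}\rangle\langle\Psi_{H,O;N}|$, the observation density matrix of the model, where $$|\Psi_{H,O;N}\rangle=\sum_{i_1,\dots,i_{N+1}}\sum_{k_1,\dots,k_N}\sqrt{\pi_{i_1}}\prod_{\ell=1}^N U^{[\ell]}_{i_\ell i_{\ell+1}}\chi^{[\ell]}_{i_\ell}(k_\ell)\;e_{i_1}\otimes\cdots\otimes e_{i_{N+1}}\otimes|k_1\cdots k_N\rangle .$$ -/

import Mathlib

open scoped Matrix BigOperators

noncomputable section

/-- The logarithm of a Hermitian matrix, by the functional calculus. Since `Real.log 0 = 0`, it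
vanishes on the kernel, so `Tr (ρ log σ)` is taken on the support of `σ`. -/
def matLog {ι : Type*} [Fintype ι] [DecidableEq ι] (ρ : Matrix ι ι ℂ) : Matrix ι ι ℂ :=
  cfc Real.log ρ

/-- The support of a Hermitian matrix: its range, which is the orthogonal complement of its
kernel. -/
def matSupport {ι : Type*} [Fintype ι] (ρ : Matrix ι ι ℂ) : Submodule ℂ (ι → ℂ) :=
  LinearMap.range ρ.mulVecLin

open Classical in
/-- The quantum (Umegaki) relative entropy `S(ρ‖σ)` of two positive semidefinite matrices:
`Tr (ρ log ρ) - Tr (ρ log σ)` if `supp ρ ⊆ supp σ`, and `+∞` otherwise. (Both traces are real.) -/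
def relEntropy {ι : Type*} [Fintype ι] [DecidableEq ι] (ρ σ : Matrix ι ι ℂ) : EReal :=
  if matSupport ρ ≤ matSupport σ then
    (((ρ * matLog ρ).trace - (ρ * matLog σ).trace).re : EReal)
  else ⊤

/-- The classical expression `x log (x / y)` for `x, y ≥ 0`, with the conventions
`0 log (0 / y) = 0` and `x log (x / 0) = +∞` for `x > 0`. -/
def klTerm (x y : ℝ) : EReal :=
  if x = 0 then 0 else if y = 0 then ⊤ else ((x * Real.log (x / y) : ℝ) : EReal)

/-- A family of MPS tensors on `N` sites: `A ℓ k` is the `m × m` matrix of the site `ℓ` that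
belongs to the basis state `|k⟩` of the `d`-dimensional space `𝒦`. -/
abbrev MPSTensors (m d N : ℕ) : Type := Fin N → Fin d → Matrix (Fin m) (Fin m) ℂ

/-- The matrix of an operator on `𝒦^{⊗N}` in the basis `|k_1 ⋯ k_N⟩`. -/
abbrev ObsMatrix (d N : ℕ) : Type := Matrix (Fin N → Fin d) (Fin N → Fin d) ℂ

/-- The gauge condition `∑_k A_k^{[ℓ]} (A_k^{[ℓ]})† = 1` at every site. -/
def GaugeCondition {m d N : ℕ} (A : MPSTensors m d N) : Prop :=
  ∀ ℓ, ∑ k, A ℓ k * (A ℓ k)ᴴ = 1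

/-- The coefficient `Tr (A_{k_1}^{[1]} ⋯ A_{k_N}^{[N]})` of `|ψ_N⟩` at `|k_1 ⋯ k_N⟩`. -/
def mpsVector {m d N : ℕ} (A : MPSTensors m d N) (k : Fin N → Fin d) : ℂ :=
  (List.ofFn fun ℓ => A ℓ (k ℓ)).prod.trace

/-- `ρ_N = (1/m) |ψ_N⟩⟨ψ_N|`. -/
def mpsDensity {m d N : ℕ} (A : MPSTensors m d N) : ObsMatrix d N :=
  (1 / (m : ℂ)) • Matrix.vecMulVec (mpsVector A) (star (mpsVector A))

/-- The product `(A_{k_1}^{[1]} ⋄ conj A_{k'_1}^{[1]}) ⋯ (A_{k_N}^{[N]} ⋄ conj A_{k'_N}^{[N]})`,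
where `⋄` is the entrywise (Schur) product, and `conj` the entrywise conjugate. -/
def schurProd {m d N : ℕ} (A : MPSTensors m d N) (k k' : Fin N → Fin d) :
    Matrix (Fin m) (Fin m) ℂ :=
  (List.ofFn fun ℓ => Matrix.hadamard (A ℓ (k ℓ)) ((A ℓ (k' ℓ)).map (starRingEnd ℂ))).prod

/-- `π† M e`, where `π† = ∑ i, π i e_i†` and `e = (1/√m) ∑ j, e_j`. -/
def sandwich {m : ℕ} (π : Fin m → ℝ) (M : Matrix (Fin m) (Fin m) ℂ) : ℂ :=
  (fun i => (π i : ℂ)) ⬝ᵥ (M *ᵥ fun _ => 1 / (Real.sqrt m : ℂ))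

/-- The observation density matrix of the tensors `A` and the initial law `π`, with entries
`√m π† (A_{k_1}^{[1]} ⋄ conj A_{k'_1}^{[1]}) ⋯ (A_{k_N}^{[N]} ⋄ conj A_{k'_N}^{[N]}) e`. -/
def tensorObsDensity {m d N : ℕ} (π : Fin m → ℝ) (A : MPSTensors m d N) : ObsMatrix d N :=
  fun k k' => (Real.sqrt m : ℂ) * sandwich π (schurProd A k k')

/-- An entangled hidden Markov model with `N` steps: an initial law `π`, hidden amplitudes `U`
with `|U_{ij}|²` stochastic, and emission amplitudes `χ` with `|χ_i(k)|²` stochastic; that is, the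
maps `e_i ↦ ∑_j U_{ij} e_i ⊗ e_j` and `e_i ↦ ∑_k χ_i(k) e_i ⊗ |k⟩` are isometries. -/
structure EHMM (m d N : ℕ) where
  init : Fin m → ℝ
  init_mem : init ∈ stdSimplex ℝ (Fin m)
  U : Fin N → Matrix (Fin m) (Fin m) ℂ
  U_stoch : ∀ ℓ i, ∑ j, ‖U ℓ i j‖ ^ 2 = 1
  χ : Fin N → Matrix (Fin m) (Fin d) ℂ
  χ_stoch : ∀ ℓ i, ∑ k, ‖χ ℓ i k‖ ^ 2 = 1

namespace EHMM

variable {m d N : ℕ}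

/-- The MPS tensors `a_{k;ij}^{[ℓ]} = U_{ij}^{[ℓ]} χ_i^{[ℓ]}(k)` of an EHMM. -/
def tensors (E : EHMM m d N) : MPSTensors m d N :=
  fun ℓ k => Matrix.of fun i j => E.U ℓ i j * E.χ ℓ i k

/-- The vector `|Ψ_{H,O;N}⟩ ∈ ℋ^{⊗(N+1)} ⊗ 𝒦^{⊗N}`, whose coefficient at
`e_{i_1 … i_{N+1}} ⊗ |k_1 ⋯ k_N⟩` is
`√π_{i_1} U^{[1]}_{i_1 i_2} ⋯ U^{[N]}_{i_N i_{N+1}} χ^{[1]}_{i_1}(k_1) ⋯ χ^{[N]}_{i_N}(k_N)`. -/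
def stateVector (E : EHMM m d N) : (Fin (N + 1) → Fin m) × (Fin N → Fin d) → ℂ :=
  fun x => (Real.sqrt (E.init (x.1 0)) : ℂ) *
    (∏ ℓ : Fin N, E.U ℓ (x.1 ℓ.castSucc) (x.1 ℓ.succ)) *
    ∏ ℓ : Fin N, E.χ ℓ (x.1 ℓ.castSucc) (x.2 ℓ)

/-- `ρ_{H,O;N} = |Ψ_{H,O;N}⟩⟨Ψ_{H,O;N}|`. -/
def jointDensity (E : EHMM m d N) :
    Matrix ((Fin (N + 1) → Fin m) × (Fin N → Fin d))
      ((Fin (N + 1) → Fin m) × (Fin N → Fin d)) ℂ :=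
  Matrix.vecMulVec E.stateVector (star E.stateVector)

/-- `ρ_{O;N}`, the partial trace of `ρ_{H,O;N}` over `ℋ^{⊗(N+1)}`. -/
def obsDensity (E : EHMM m d N) : ObsMatrix d N :=
  fun k k' => ∑ i : Fin (N + 1) → Fin m, E.jointDensity (i, k) (i, k')

end EHMM

end

/-! The inequality is monotonicity of relative entropy under measurement in the basis `|k⟩`, proved
directly for a rank-one first argument `φφ†` (`sum_klTerm_diag_le_relEntropy`). With `t = ‖φ‖²`, `p
k = |φ k|²`, and `λ a`, `μ a` the eigenvalues of `σ` and the weights of `φ` on its eigenvectors, the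
finite case reads `∑ μ log λ ≤ ∑ p log r`, where `r k = t σ_kk / p k`. Since the logarithm is an
integral of resolvents and both weights have mass `t`, it suffices to compare `∑ p/(r+s) ≤ ∑
μ/(λ+s)` for `s > 0`. The right side is `⟨φ, (σ+s)⁻¹ φ⟩ = sup_x (2 Re⟨x,φ⟩ - ⟨x,(σ+s)x⟩)`, and the
trial vector `x k = φ k / (r k + s)` gives the bound. Positivity of the observation density, and its
agreement with the partial trace, both come from expanding matrix products over hidden paths. -/

/-! ### Matrix products as sums over paths -/

section PathExpansion

variable {m : ℕ} {R : Type*} [CommSemiring R]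

theorem Matrix.sum_list_ofFn_prod_apply {N : ℕ} (M : Fin N → Matrix (Fin m) (Fin m) R)
    (i : Fin m) :
    ∑ j, (List.ofFn M).prod i j =
      ∑ w : Fin N → Fin m, ∏ ℓ : Fin N,
        M ℓ ((Fin.cons i w : Fin (N + 1) → Fin m) ℓ.castSucc) (w ℓ) := by
  induction N generalizing i with
  | zero => simp [Matrix.one_apply]
  | succ N ih =>
    rw [← (Fin.consEquiv fun _ : Fin (N + 1) => Fin m).sum_comp, Fintype.sum_prod_type]
    simp only [List.ofFn_succ, List.prod_cons, Matrix.mul_apply]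
    rw [Finset.sum_comm]
    refine Finset.sum_congr rfl fun j _ => ?_
    rw [← Finset.mul_sum, ih, Finset.mul_sum]
    refine Finset.sum_congr rfl fun w _ => ?_
    rw [Fin.prod_univ_succ]
    simp [Fin.consEquiv]

theorem Matrix.sum_mul_sum_list_ofFn_prod_apply {N : ℕ} (c : Fin m → R)
    (M : Fin N → Matrix (Fin m) (Fin m) R) :
    ∑ i, c i * ∑ j, (List.ofFn M).prod i j =
      ∑ w : Fin (N + 1) → Fin m, c (w 0) * ∏ ℓ : Fin N, M ℓ (w ℓ.castSucc) (w ℓ.succ) := by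
  rw [← (Fin.consEquiv fun _ : Fin (N + 1) => Fin m).sum_comp, Fintype.sum_prod_type]
  refine Finset.sum_congr rfl fun i _ => ?_
  rw [Matrix.sum_list_ofFn_prod_apply, Finset.mul_sum]
  simp [Fin.consEquiv]

end PathExpansion

/-! ### The observation density as a mixture of rank-one matrices -/

section ObservationDensity

open scoped ComplexOrder

variable {m d N : ℕ}

/-- The amplitude of the hidden path `w` and the observations `k`. -/
def pathAmplitude (A : MPSTensors m d N) (w : Fin (N + 1) → Fin m) (k : Fin N → Fin d) : ℂ :=
  ∏ ℓ : Fin N, A ℓ (k ℓ) (w ℓ.castSucc) (w ℓ.succ)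

theorem tensorObsDensity_apply (hm : m ≠ 0) (π : Fin m → ℝ) (A : MPSTensors m d N)
    (k k' : Fin N → Fin d) :
    tensorObsDensity π A k k' =
      ∑ w, (π (w 0) : ℂ) * (pathAmplitude A w k * star (pathAmplitude A w k')) := by
  have hs : (Real.sqrt m : ℂ) ≠ 0 := by
    simpa using hm
  have h := Matrix.sum_mul_sum_list_ofFn_prod_apply (fun i => (π i : ℂ))
    fun ℓ => Matrix.hadamard (A ℓ (k ℓ)) ((A ℓ (k' ℓ)).map (starRingEnd ℂ))
  simp only [Matrix.hadamard_apply, Matrix.map_apply, Finset.prod_mul_distrib] at h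
  have h2 : tensorObsDensity π A k k' = ∑ i, (π i : ℂ) * ∑ j, schurProd A k k' i j := by
    simp only [tensorObsDensity, sandwich, dotProduct, Matrix.mulVec, Finset.mul_sum]
    refine Finset.sum_congr rfl fun i _ => Finset.sum_congr rfl fun j _ => ?_
    field_simp
  rw [h2]
  simp only [schurProd]
  rw [h]
  simp [pathAmplitude]

theorem tensorObsDensity_eq_sum (hm : m ≠ 0) (π : Fin m → ℝ) (A : MPSTensors m d N) :
    tensorObsDensity π A =
      ∑ w, (π (w 0) : ℂ) •
        Matrix.vecMulVec (pathAmplitude A w) (star (pathAmplitude A w)) := by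
  ext k k'
  simp [tensorObsDensity_apply hm, Matrix.sum_apply, Matrix.vecMulVec_apply]

theorem posSemidef_tensorObsDensity {π : Fin m → ℝ} (hπ : 0 ≤ π) (hm : m ≠ 0)
    (A : MPSTensors m d N) : (tensorObsDensity π A).PosSemidef := by
  rw [tensorObsDensity_eq_sum hm]
  refine Matrix.posSemidef_sum _ fun w _ => ?_
  exact (Matrix.posSemidef_vecMulVec_self_star _).smul (by exact_mod_cast hπ (w 0))

theorem EHMM.obsDensity_eq (E : EHMM m d N) (hm : m ≠ 0) :
    E.obsDensity = tensorObsDensity E.init E.tensors := by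
  ext k k'
  rw [tensorObsDensity_apply hm]
  refine Finset.sum_congr rfl fun w _ => ?_
  have h : (E.init (w 0) : ℂ) = (Real.sqrt (E.init (w 0)) : ℂ) * Real.sqrt (E.init (w 0)) := by
    rw [← Complex.ofReal_mul, Real.mul_self_sqrt (E.init_mem.1 _)]
  rw [h]
  simp [EHMM.jointDensity, Matrix.vecMulVec_apply, EHMM.stateVector, pathAmplitude,
    EHMM.tensors, Finset.prod_mul_distrib]
  ring

end ObservationDensity

/-! ### From resolvents to logarithms -/

section ResolventToLog

variable {ι κ : Type*} [Fintype ι] [Fintype κ]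

theorem tendsto_sum_mul_log_add_sub_log (p r : ι → ℝ) :
    Filter.Tendsto (fun s : ℝ => ∑ k, p k * (Real.log (r k + s) - Real.log s))
      Filter.atTop (nhds 0) := by
  rw [show (0 : ℝ) = ∑ k : ι, p k * 0 by simp]
  refine tendsto_finsetSum _ fun k _ => Filter.Tendsto.const_mul _ ?_
  have h := Real.tendsto_log_comp_add_sub_log (r k)
  simpa only [add_comm] using h

theorem hasDerivAt_sum_mul_log_add {p r : ι → ℝ} (hr : ∀ k, p k ≠ 0 → 0 < r k) {s : ℝ}
    (hs : 0 ≤ s) :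
    HasDerivAt (fun s => ∑ k, p k * Real.log (r k + s)) (∑ k, p k / (r k + s)) s := by
  refine HasDerivAt.fun_sum fun k _ => ?_
  by_cases hk : p k = 0
  · simpa [hk] using hasDerivAt_const s (0 : ℝ)
  · have h0 : r k + s ≠ 0 := (add_pos_of_pos_of_nonneg (hr k hk) hs).ne'
    have h := (((hasDerivAt_id' s).const_add (r k)).log h0).const_mul (p k)
    rwa [mul_one_div] at h

/-- If two finite measures on `(0, ∞)` of equal mass have comparable Stieltjes transforms, their
logarithmic moments are comparable in the opposite direction. -/
theorem sum_mul_log_le_of_sum_div_add_le {p r : ι → ℝ} {μ l : κ → ℝ}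
    (hr : ∀ k, p k ≠ 0 → 0 < r k) (hl : ∀ a, μ a ≠ 0 → 0 < l a)
    (hmass : ∑ k, p k = ∑ a, μ a)
    (hres : ∀ s, 0 < s → ∑ k, p k / (r k + s) ≤ ∑ a, μ a / (l a + s)) :
    ∑ a, μ a * Real.log (l a) ≤ ∑ k, p k * Real.log (r k) := by
  set F : ℝ → ℝ := fun s => ∑ k, p k * Real.log (r k + s) - ∑ a, μ a * Real.log (l a + s)
    with hF
  have hder : ∀ s, 0 ≤ s →
      HasDerivAt F (∑ k, p k / (r k + s) - ∑ a, μ a / (l a + s)) s := fun s hs =>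
    (hasDerivAt_sum_mul_log_add hr hs).sub (hasDerivAt_sum_mul_log_add hl hs)
  have hanti : AntitoneOn F (Set.Ici 0) := by
    refine antitoneOn_of_deriv_nonpos (convex_Ici 0)
      (fun s hs => (hder s hs).continuousAt.continuousWithinAt)
      (fun s hs => ?_) fun s hs => ?_
    · rw [interior_Ici] at hs
      exact (hder s (le_of_lt hs)).differentiableAt.differentiableWithinAt
    · rw [interior_Ici] at hs
      rw [(hder s (le_of_lt hs)).deriv]
      exact sub_nonpos.2 (hres s hs)
  -- Equal masses let `log s` be subtracted from every logarithm without changing `F`.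
  have hlim : Filter.Tendsto F Filter.atTop (nhds 0) := by
    have h := (tendsto_sum_mul_log_add_sub_log p r).sub (tendsto_sum_mul_log_add_sub_log μ l)
    rw [sub_zero] at h
    refine h.congr fun s => ?_
    simp only [hF, mul_sub, Finset.sum_sub_distrib, ← Finset.sum_mul, hmass]
    ring
  have h0 : 0 ≤ F 0 := le_of_tendsto hlim <| by
    filter_upwards [Filter.eventually_ge_atTop 0] with s hs
    exact hanti (Set.mem_Ici.2 le_rfl) hs hs
  simpa [hF] using h0

end ResolventToLog

/-! ### Spectral coordinates and the resolvent bound -/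

section Spectral

open scoped ComplexOrder

variable {ι : Type*} [Fintype ι] [DecidableEq ι]

/-- The coordinates of `x` in the eigenvector basis of a Hermitian matrix. -/
noncomputable def Matrix.IsHermitian.coords {A : Matrix ι ι ℂ} (hA : A.IsHermitian)
    (x : ι → ℂ) : ι → ℂ :=
  (hA.eigenvectorUnitary : Matrix ι ι ℂ)ᴴ *ᵥ x

namespace Matrix.IsHermitian

variable {A : Matrix ι ι ℂ} (hA : A.IsHermitian)

theorem cfc_eq_mul_diagonal_mul (f : ℝ → ℝ) :
    cfc f A = (hA.eigenvectorUnitary : Matrix ι ι ℂ) *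
      Matrix.diagonal (fun a => (f (hA.eigenvalues a) : ℂ)) *
      (hA.eigenvectorUnitary : Matrix ι ι ℂ)ᴴ := by
  rw [hA.cfc_eq, Matrix.IsHermitian.cfc, Unitary.conjStarAlgAut_apply]
  rfl

theorem coords_cfc_mulVec (f : ℝ → ℝ) (x : ι → ℂ) (a : ι) :
    hA.coords (cfc f A *ᵥ x) a = f (hA.eigenvalues a) * hA.coords x a := by
  have hU : (hA.eigenvectorUnitary : Matrix ι ι ℂ)ᴴ * hA.eigenvectorUnitary = 1 :=
    Unitary.coe_star_mul_self hA.eigenvectorUnitary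
  rw [hA.cfc_eq_mul_diagonal_mul, coords, Matrix.mulVec_mulVec, ← Matrix.mul_assoc,
    ← Matrix.mul_assoc, hU, Matrix.one_mul, ← Matrix.mulVec_mulVec, Matrix.mulVec_diagonal,
    coords]

theorem star_coords_dotProduct_coords (x y : ι → ℂ) :
    star (hA.coords x) ⬝ᵥ hA.coords y = star x ⬝ᵥ y := by
  have hU : (hA.eigenvectorUnitary : Matrix ι ι ℂ) * (hA.eigenvectorUnitary : Matrix ι ι ℂ)ᴴ = 1 :=
    Unitary.coe_mul_star_self hA.eigenvectorUnitary
  rw [coords, coords, Matrix.star_mulVec, Matrix.conjTranspose_conjTranspose,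
    ← Matrix.dotProduct_mulVec, Matrix.mulVec_mulVec, hU, Matrix.one_mulVec]

theorem sum_norm_sq_coords (x : ι → ℂ) : ∑ a, ‖hA.coords x a‖ ^ 2 = ∑ k, ‖x k‖ ^ 2 := by
  have h := hA.star_coords_dotProduct_coords x x
  simp only [dotProduct, Pi.star_apply, RCLike.star_def, Complex.conj_mul'] at h
  exact_mod_cast h

theorem star_dotProduct_cfc_mulVec (f : ℝ → ℝ) (x : ι → ℂ) :
    star x ⬝ᵥ (cfc f A *ᵥ x) =
      ((∑ a, f (hA.eigenvalues a) * ‖hA.coords x a‖ ^ 2 : ℝ) : ℂ) := by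
  rw [← hA.star_coords_dotProduct_coords]
  simp only [dotProduct, Pi.star_apply, RCLike.star_def, hA.coords_cfc_mulVec]
  push_cast
  refine Finset.sum_congr rfl fun a _ => ?_
  rw [← Complex.conj_mul']
  ring

theorem coords_mulVec (x : ι → ℂ) (a : ι) :
    hA.coords (A *ᵥ x) a = hA.eigenvalues a * hA.coords x a := by
  have h := hA.coords_cfc_mulVec id x a
  rwa [cfc_id ℝ A hA.isSelfAdjoint] at h

theorem diag_eq_sum (k : ι) :
    (A k k).re = ∑ a, hA.eigenvalues a * ‖(hA.eigenvectorUnitary : Matrix ι ι ℂ) k a‖ ^ 2 := by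
  have h := hA.star_dotProduct_cfc_mulVec id (Pi.single k 1)
  rw [cfc_id ℝ A hA.isSelfAdjoint] at h
  have h1 : star (Pi.single k (1 : ℂ) : ι → ℂ) = Pi.single k 1 := by
    ext j
    by_cases hj : j = k <;> simp [hj]
  rw [h1] at h
  simp [coords] at h
  rw [h]
  exact_mod_cast Complex.ofReal_re _

end Matrix.IsHermitian


theorem norm_sq_coords_diag_mul_le {σ : Matrix ι ι ℂ} (hσ : σ.IsHermitian) (b : ι → ℝ) (φ : ι → ℂ)
    (a : ι) :
    ‖hσ.coords (fun k => (b k : ℂ) * φ k) a‖ ^ 2 ≤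
      (∑ k, ‖(hσ.eigenvectorUnitary : Matrix ι ι ℂ) k a‖ ^ 2 * b k ^ 2) * ∑ k, ‖φ k‖ ^ 2 := by
  have h1 : ‖hσ.coords (fun k => (b k : ℂ) * φ k) a‖ ≤
      ∑ k, (‖(hσ.eigenvectorUnitary : Matrix ι ι ℂ) k a‖ * |b k|) * ‖φ k‖ := by
    refine (norm_sum_le _ _).trans_eq (Finset.sum_congr rfl fun k _ => ?_)
    simp [mul_assoc]
  refine (pow_le_pow_left₀ (norm_nonneg _) h1 2).trans ?_
  refine (Finset.sum_mul_sq_le_sq_mul_sq _ _ _).trans_eq ?_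
  simp [mul_pow]

/-- Conjugating `φφ† ≤ ‖φ‖² · 1` by `diag b` and tracing against `σ ≥ 0` removes the off-diagonal
entries of `σ`; in coordinates this is Cauchy–Schwarz on each eigenvector. -/
theorem sum_eigenvalues_mul_norm_sq_coords_le {σ : Matrix ι ι ℂ} (hσ : σ.PosSemidef) (b : ι → ℝ)
    (φ : ι → ℂ) :
    ∑ a, hσ.isHermitian.eigenvalues a *
        ‖hσ.isHermitian.coords (fun k => (b k : ℂ) * φ k) a‖ ^ 2 ≤
      ∑ k, b k ^ 2 * ((∑ k, ‖φ k‖ ^ 2) * (σ k k).re) := by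
  calc _ ≤ ∑ a, hσ.isHermitian.eigenvalues a *
        ((∑ k, ‖(hσ.isHermitian.eigenvectorUnitary : Matrix ι ι ℂ) k a‖ ^ 2 * b k ^ 2) *
          ∑ k, ‖φ k‖ ^ 2) := Finset.sum_le_sum fun a _ =>
        mul_le_mul_of_nonneg_left (norm_sq_coords_diag_mul_le _ b φ a) (hσ.eigenvalues_nonneg a)
    _ = _ := by
        simp only [hσ.isHermitian.diag_eq_sum]
        generalize (hσ.isHermitian.eigenvectorUnitary : Matrix ι ι ℂ) = V
        generalize ∑ k, ‖φ k‖ ^ 2 = t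
        simp only [Finset.mul_sum, Finset.sum_mul]
        rw [Finset.sum_comm]
        exact Finset.sum_congr rfl fun k _ => Finset.sum_congr rfl fun a _ => by ring

/-- The resolvent of a positive semidefinite matrix in a vector state dominates the one of the
diagonal. -/
theorem sum_div_diag_add_le_sum_div_eigenvalues_add {σ : Matrix ι ι ℂ} (hσ : σ.PosSemidef)
    (φ : ι → ℂ) {s : ℝ} (hs : 0 < s) :
    ∑ k, ‖φ k‖ ^ 2 / ((∑ k, ‖φ k‖ ^ 2) * (σ k k).re / ‖φ k‖ ^ 2 + s) ≤
      ∑ a, ‖hσ.isHermitian.coords φ a‖ ^ 2 / (hσ.isHermitian.eigenvalues a + s) := by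
  set t := ∑ k, ‖φ k‖ ^ 2
  have ht : 0 ≤ t := by positivity
  have hq : ∀ k, 0 ≤ (σ k k).re := fun k => (Complex.le_def.1 (hσ.diag_nonneg (i := k))).1
  -- The value `0` where `φ k = 0` is needed: there the quotient is junk, and a nonzero `b k` would
  -- leave `b k ^ 2 * t * σ_kk` uncompensated in `hb2`.
  set b : ι → ℝ := fun k => if φ k = 0 then 0 else (t * (σ k k).re / ‖φ k‖ ^ 2 + s)⁻¹ with hb
  set x : ι → ℂ := fun k => (b k : ℂ) * φ k with hx
  set lam := hσ.isHermitian.eigenvalues with hlam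
  set z := hσ.isHermitian.coords x
  set y := hσ.isHermitian.coords φ
  -- The variational bound for the resolvent, one eigenvector at a time.
  have hterm : ∀ a, 2 * (star (z a) * y a).re - (lam a + s) * ‖z a‖ ^ 2 ≤
      ‖y a‖ ^ 2 / (lam a + s) := fun a => by
    have hpos : 0 < lam a + s := add_pos_of_nonneg_of_pos (hσ.eigenvalues_nonneg a) hs
    have h1 : (star (z a) * y a).re ≤ ‖z a‖ * ‖y a‖ := by
      simpa using Complex.re_le_norm (star (z a) * y a)
    rw [le_div_iff₀ hpos]
    nlinarith [sq_nonneg ((lam a + s) * ‖z a‖ - ‖y a‖)]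
  have hinner : ∑ a, (star (z a) * y a).re = ∑ k, b k * ‖φ k‖ ^ 2 := by
    have h := congrArg Complex.re (hσ.isHermitian.star_coords_dotProduct_coords x φ)
    simp only [dotProduct, Complex.re_sum, Pi.star_apply] at h
    refine h.trans (Finset.sum_congr rfl fun k _ => ?_)
    rw [hx, star_mul', RCLike.star_def, Complex.conj_ofReal, mul_assoc,
      Complex.conj_mul']
    exact_mod_cast Complex.ofReal_re _
  have hnorm : ∑ a, ‖z a‖ ^ 2 = ∑ k, b k ^ 2 * ‖φ k‖ ^ 2 := by
    rw [hσ.isHermitian.sum_norm_sq_coords]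
    simp [hx, mul_pow]
  have hquad := sum_eigenvalues_mul_norm_sq_coords_le hσ b φ
  have hsum := Finset.sum_le_sum fun a (_ : a ∈ Finset.univ) => hterm a
  simp only [Finset.sum_sub_distrib, add_mul, Finset.sum_add_distrib, ← Finset.mul_sum] at hsum
  rw [hinner, hnorm] at hsum
  have hb2 : ∑ k, ‖φ k‖ ^ 2 / (t * (σ k k).re / ‖φ k‖ ^ 2 + s) =
      2 * ∑ k, b k * ‖φ k‖ ^ 2 -
        (∑ k, b k ^ 2 * (t * (σ k k).re) + s * ∑ k, b k ^ 2 * ‖φ k‖ ^ 2) := by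
    simp only [Finset.mul_sum, ← Finset.sum_sub_distrib, ← Finset.sum_add_distrib]
    refine Finset.sum_congr rfl fun k _ => ?_
    by_cases hk : φ k = 0
    · simp [hb, hk]
    · have hp : 0 < ‖φ k‖ ^ 2 := by positivity
      have hd : 0 < t * (σ k k).re + s * ‖φ k‖ ^ 2 :=
        add_pos_of_nonneg_of_pos (mul_nonneg ht (hq k)) (mul_pos hs hp)
      simp only [hb, hk, if_false]
      field_simp
      ring
  rw [hb2]
  linarith

end Spectral

theorem EReal.coe_finsetSum {ι : Type*} (s : Finset ι) (f : ι → ℝ) :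
    ((∑ i ∈ s, f i : ℝ) : EReal) = ∑ i ∈ s, (f i : EReal) :=
  map_sum (⟨⟨Real.toEReal, EReal.coe_zero⟩, EReal.coe_add⟩ : ℝ →+ EReal) f s

theorem EReal.coe_mul_sum_of_nonneg {ι : Type*} {c : ℝ} (hc : 0 ≤ c) (s : Finset ι)
    (f : ι → EReal) : (c : EReal) * ∑ i ∈ s, f i = ∑ i ∈ s, (c : EReal) * f i := by
  classical
  induction s using Finset.induction_on with
  | empty => simp
  | insert a s ha ih =>
    rw [Finset.sum_insert ha, Finset.sum_insert ha, ← ih]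
    exact EReal.left_distrib_of_nonneg_of_ne_top (by exact_mod_cast hc) (EReal.coe_ne_top c) _ _

/-! ### Relative entropy of a rank-one matrix -/

section RankOne

open scoped ComplexOrder

variable {ι : Type*} [Fintype ι]

theorem trace_vecMulVec_star_mul (φ : ι → ℂ) (M : Matrix ι ι ℂ) :
    (Matrix.vecMulVec φ (star φ) * M).trace = star φ ⬝ᵥ (M *ᵥ φ) := by
  rw [Matrix.trace_mul_comm, Matrix.mul_vecMulVec, Matrix.trace_vecMulVec, dotProduct_comm]

theorem star_dotProduct_self_eq_sum (φ : ι → ℂ) :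
    star φ ⬝ᵥ φ = ((∑ k, ‖φ k‖ ^ 2 : ℝ) : ℂ) := by
  simp [dotProduct, Complex.conj_mul']

theorem exists_mulVec_eq_of_matSupport_le {φ : ι → ℂ} {σ : Matrix ι ι ℂ}
    (h : matSupport (Matrix.vecMulVec φ (star φ)) ≤ matSupport σ) : ∃ z, σ *ᵥ z = φ := by
  by_cases hφ : φ = 0
  · exact ⟨0, by simp [hφ]⟩
  · have h0 : star φ ⬝ᵥ φ ≠ 0 := by simpa [dotProduct_star_self_eq_zero] using hφ
    refine h ⟨(star φ ⬝ᵥ φ)⁻¹ • φ, ?_⟩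
    rw [Matrix.mulVecLin_apply, Matrix.mulVec_smul, Matrix.vecMulVec_mulVec]
    ext k
    simp [field]

variable [DecidableEq ι]

theorem trace_vecMulVec_star_mul_matLog (φ : ι → ℂ) :
    ((Matrix.vecMulVec φ (star φ) * matLog (Matrix.vecMulVec φ (star φ))).trace).re =
      (∑ k, ‖φ k‖ ^ 2) * Real.log (∑ k, ‖φ k‖ ^ 2) := by
  have hρ := (Matrix.posSemidef_vecMulVec_self_star φ).isHermitian
  set t := ∑ k, ‖φ k‖ ^ 2 with ht
  have hmul : Matrix.vecMulVec φ (star φ) *ᵥ φ = (t : ℂ) • φ := by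
    rw [Matrix.vecMulVec_mulVec, star_dotProduct_self_eq_sum]
    exact op_smul_eq_smul _ _
  -- `φ` is an eigenvector for `t`, so it has coordinates only in that eigenspace.
  have hlam : ∀ a, hρ.coords φ a ≠ 0 → hρ.eigenvalues a = t := fun a ha => by
    have h := hρ.coords_mulVec φ a
    rw [hmul, Matrix.IsHermitian.coords, Matrix.mulVec_smul] at h
    have h2 := mul_right_cancel₀ ha (show (t : ℂ) * hρ.coords φ a = _ from h)
    exact_mod_cast h2.symm
  rw [trace_vecMulVec_star_mul, matLog, hρ.star_dotProduct_cfc_mulVec, Complex.ofReal_re,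
    ht, ← hρ.sum_norm_sq_coords φ, Finset.sum_mul]
  refine Finset.sum_congr rfl fun a _ => ?_
  by_cases ha : hρ.coords φ a = 0
  · simp [ha]
  · rw [hlam a ha, hρ.sum_norm_sq_coords φ, mul_comm]

theorem sum_klTerm_diag_le_relEntropy {σ : Matrix ι ι ℂ} (hσ : σ.PosSemidef) (φ : ι → ℂ) :
    ∑ k, klTerm (‖φ k‖ ^ 2) (σ k k).re ≤ relEntropy (Matrix.vecMulVec φ (star φ)) σ := by
  by_cases hsupp : matSupport (Matrix.vecMulVec φ (star φ)) ≤ matSupport σ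
  swap
  · simp [relEntropy, hsupp]
  obtain ⟨z, hz⟩ := exists_mulVec_eq_of_matSupport_le hsupp
  have hH := hσ.isHermitian
  set t := ∑ k, ‖φ k‖ ^ 2 with ht
  have hq : ∀ k, 0 ≤ (σ k k).re := fun k => (Complex.le_def.1 (hσ.diag_nonneg (i := k))).1
  have hl : ∀ a, ‖hH.coords φ a‖ ^ 2 ≠ 0 → 0 < hH.eigenvalues a := fun a ha => by
    refine (hσ.eigenvalues_nonneg a).lt_of_ne' fun h0 => ha ?_
    rw [← hz, hH.coords_mulVec, h0]
    simp
  -- A zero diagonal entry of `σ ≥ 0` kills its whole row, hence the entry `φ k` of `φ = σ z`.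
  have hqpos : ∀ k, φ k ≠ 0 → 0 < (σ k k).re := fun k hk => by
    refine (hq k).lt_of_ne' fun h0 => hk ?_
    rw [hH.diag_eq_sum, Finset.sum_eq_zero_iff_of_nonneg fun a _ =>
      mul_nonneg (hσ.eigenvalues_nonneg a) (sq_nonneg _)] at h0
    rw [← hz, ← cfc_id ℝ σ hH.isSelfAdjoint, hH.cfc_eq_mul_diagonal_mul, Matrix.mul_assoc,
      ← Matrix.mulVec_mulVec, ← Matrix.mulVec_mulVec]
    refine Finset.sum_eq_zero fun a _ => ?_
    rw [Matrix.mulVec_diagonal]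
    rcases mul_eq_zero.1 (h0 a (Finset.mem_univ a)) with h | h
    · simp [h]
    · exact mul_eq_zero_of_left (norm_eq_zero.1 ((pow_eq_zero_iff two_ne_zero).1 h)) _
  have htpos : ∀ k, φ k ≠ 0 → 0 < t := fun k hk =>
    (show 0 < ‖φ k‖ ^ 2 by positivity).trans_le
      (Finset.single_le_sum (f := fun k => ‖φ k‖ ^ 2) (fun _ _ => sq_nonneg _) (Finset.mem_univ k))
  have hlog := sum_mul_log_le_of_sum_div_add_le
    (p := fun k => ‖φ k‖ ^ 2) (r := fun k => t * (σ k k).re / ‖φ k‖ ^ 2)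
    (μ := fun a => ‖hH.coords φ a‖ ^ 2) (l := hH.eigenvalues)
    (fun k hk => by
      have hk : φ k ≠ 0 := by simpa using hk
      have := htpos k hk
      have := hqpos k hk
      positivity)
    hl (hH.sum_norm_sq_coords φ).symm
    (fun s hs => sum_div_diag_add_le_sum_div_eigenvalues_add hσ φ hs)
  have hkl : ∀ k, klTerm (‖φ k‖ ^ 2) (σ k k).re =
      ((‖φ k‖ ^ 2 * Real.log t -
        ‖φ k‖ ^ 2 * Real.log (t * (σ k k).re / ‖φ k‖ ^ 2) : ℝ) : EReal) := fun k => by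
    by_cases hk : φ k = 0
    · simp [klTerm, hk]
    · have hp : ‖φ k‖ ^ 2 ≠ 0 := by simpa using hk
      have hq' := (hqpos k hk).ne'
      have ht' := (htpos k hk).ne'
      rw [klTerm, if_neg hp, if_neg hq', Real.log_div hp hq',
        Real.log_div (mul_ne_zero ht' hq') hp, Real.log_mul ht' hq']
      congr 1
      ring
  rw [relEntropy, if_pos hsupp, Complex.sub_re, trace_vecMulVec_star_mul_matLog,
    trace_vecMulVec_star_mul, matLog, hH.star_dotProduct_cfc_mulVec, Complex.ofReal_re,
    Finset.sum_congr rfl fun k _ => hkl k, ← EReal.coe_finsetSum, EReal.coe_le_coe_iff,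
    Finset.sum_sub_distrib, ← Finset.sum_mul]
  simp only [mul_comm (Real.log (hH.eigenvalues _))]
  linarith

end RankOne

/-! ### Normalization and the main theorem -/

theorem coe_mul_klTerm {c : ℝ} (hc : 0 < c) (x y : ℝ) :
    (c : EReal) * klTerm x y = klTerm (c * x) (c * y) := by
  unfold klTerm
  by_cases hx : x = 0
  · simp [hx]
  by_cases hy : y = 0
  · simp [hx, hy, hc.ne', EReal.coe_mul_top_of_pos hc]
  · simp only [hx, hy, mul_eq_zero, hc.ne', or_self, if_false]
    rw [mul_div_mul_left _ _ hc.ne', ← EReal.coe_mul, mul_assoc]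

theorem mpsDensity_eq_vecMulVec {m d N : ℕ} (A : MPSTensors m d N) :
    mpsDensity A = Matrix.vecMulVec (((Real.sqrt m)⁻¹ : ℂ) • mpsVector A)
      (star (((Real.sqrt m)⁻¹ : ℂ) • mpsVector A)) := by
  have h : ((m : ℂ))⁻¹ = ((Real.sqrt m)⁻¹ : ℂ) * ((Real.sqrt m)⁻¹ : ℂ) := by
    rw [← mul_inv, ← Complex.ofReal_mul, Real.mul_self_sqrt (Nat.cast_nonneg m)]
    simp
  ext k k'
  simp [mpsDensity, Matrix.vecMulVec_apply, h]
  ring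

theorem theorem3p3 {m d N : ℕ} (π : Fin m → ℝ) (hπ : π ∈ stdSimplex ℝ (Fin m))
    (A : MPSTensors m d N) (hA : GaugeCondition A) :
    (((1 / (m : ℝ) : ℝ) : EReal) * ∑ k : Fin N → Fin d,
          klTerm (‖(List.ofFn fun ℓ => A ℓ (k ℓ)).prod.trace‖ ^ 2)
            ((m : ℝ) ^ (3 / 2 : ℝ) * (sandwich π (schurProd A k k)).re)
        ≤ relEntropy (mpsDensity A) (tensorObsDensity π A)) ∧
    ∀ E : EHMM m d N, E.init = π → E.tensors = A →
      ((1 / (m : ℝ) : ℝ) : EReal) * ∑ k : Fin N → Fin d,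
          klTerm (‖(List.ofFn fun ℓ => A ℓ (k ℓ)).prod.trace‖ ^ 2)
            ((m : ℝ) ^ (3 / 2 : ℝ) * (sandwich π (schurProd A k k)).re)
        ≤ relEntropy (mpsDensity A) E.obsDensity := by
  have hm : m ≠ 0 := by
    rintro rfl
    simpa using hπ.2
  have main : ((1 / (m : ℝ) : ℝ) : EReal) * ∑ k : Fin N → Fin d,
      klTerm (‖(List.ofFn fun ℓ => A ℓ (k ℓ)).prod.trace‖ ^ 2)
        ((m : ℝ) ^ (3 / 2 : ℝ) * (sandwich π (schurProd A k k)).re)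
      ≤ relEntropy (mpsDensity A) (tensorObsDensity π A) := by
    have hm0 : (0 : ℝ) < m := by positivity
    have hc : (0 : ℝ) < 1 / m := by positivity
    rw [EReal.coe_mul_sum_of_nonneg hc.le, mpsDensity_eq_vecMulVec]
    refine le_of_eq_of_le (Finset.sum_congr rfl fun k _ => ?_)
      (sum_klTerm_diag_le_relEntropy (posSemidef_tensorObsDensity hπ.1 hm A) _)
    rw [coe_mul_klTerm hc]
    congr 1
    · simp [mpsVector, mul_pow]
    -- The prefactor `1/m` turns `m^(3/2)` into the `√m` of the observation density.
    · have h32 : (m : ℝ) ^ (3 / 2 : ℝ) = m * Real.sqrt m := by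
        rw [Real.sqrt_eq_rpow, ← Real.rpow_one_add' hm0.le (by norm_num)]
        norm_num
      rw [tensorObsDensity, Complex.re_ofReal_mul, h32]
      field_simp
  refine ⟨main, ?_⟩
  rintro E rfl rfl
  rwa [E.obsDensity_eq hm]
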